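/- Vector lattices are real. Let $E$ be an Archimedean vector lattice, $F$ a Dedekind complete vector lattice, and $E^\delta$ a Dedekind completion of $E$, that is, a Dedekind complete vector lattice containing $E$ as a majorizing, order dense vector sublattice. Let $\mathcal T$ be a set of positive linear operators from $E$ to $F$. For a positive linear operator $T:E\to F$, let $T^\delta:E^\delta\to F$ denote the linear operator satisfying $$T^\delta y=\sup\{Tx:\ x\in E,\ x\le y\}\qquad (y\in E^\delta,\ y\ge 0);$$ there is at most one such operator, and $T^\delta$ is said to exist if there is one. A net $(x_\alpha)$ in a vector lattice order converges to $0$ if there is a net $(g_\beta)$, possibly with another index set, such that $g_\beta\downarrow 0$ and for each $\beta$ there is $\alpha_\beta$ with $|x_\alpha|\le g_\beta$ for all $\alpha\ge\alpha_\beta$. A set $\mathcal S$ of linear operators between vector lattices $X$ and $Y$ is collectively order continuous if for every net $(x_\alpha)$ in $X$ that order converges to $0$ there is a net $g_\beta\downarrow 0$ in $Y$ such that for each $\beta$ there is $\alpha_\beta$ with $|Sx_\alpha|\le g_\beta$ for all $\alpha\ge\alpha_\beta$ and all $S\in\mathcal S$. Then the following are equivalent: 1. $T^\delta$ exists for every $T\in\mathcal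 T$, and the set $\mathcal T^\delta=\{T^\delta: T\in\mathcal T\}$ of operators from $E^\delta$ to $F$ is collectively order continuous. 2. $\mathcal T$ is collectively order continuous. -/

import Mathlib

/-! A vector lattice is a real vector space `E` with
`[AddCommGroup E] [Lattice E] [IsOrderedAddMonoid E] [Module ℝ E] [IsOrderedModule ℝ E]`.
It is Dedekind complete when its lattice structure is a `ConditionallyCompleteLattice`
(nonempty order bounded sets have suprema and infima). -/

namespace VL

universe u v w

/-- A vector lattice is Archimedean if `0 ≤ x` and `n x ≤ y` for all `n` force `x = 0`.
(Mathlib's class `Archimedean` is not this notion: on a non-linear order it asks every positive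
element to be a strong unit.) -/
def IsArchimedean (E : Type u) [AddCommGroup E] [Lattice E] : Prop :=
  ∀ x y : E, 0 ≤ x → (∀ n : ℕ, n • x ≤ y) → x = 0

/-- `g ↓ 0`: the net `g` is decreasing with infimum `0`. -/
def DecreasesToZero {B : Type w} [Preorder B] {E : Type u} [AddCommGroup E] [Lattice E]
    (g : B → E) : Prop :=
  Antitone g ∧ IsGLB (Set.range g) 0

/-- Order convergence of a net `x` to `l`, with a dominating net `g ↓ 0` that may have its own
index set. Index sets of dominating nets are taken in the universe of `E`, which is no restriction:
`g` can always be replaced by the set of its values, indexed by itself with the reversed order. -/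
def OrderConverges {A : Type w} [Preorder A] {E : Type u} [AddCommGroup E] [Lattice E]
    (x : A → E) (l : E) : Prop :=
  ∃ (B : Type u) (_ : Preorder B) (_ : IsDirectedOrder B) (_ : Nonempty B) (g : B → E),
    DecreasesToZero g ∧ ∀ b : B, ∃ a₀ : A, ∀ a : A, a₀ ≤ a → |x a - l| ≤ g b

/-- Collective order convergence to `0` of a set `N` of nets with the same index set: one net
`g ↓ 0` dominates all members of `N`, with tails chosen independently of the member. -/
def CollectivelyOrderConvergesToZero {A : Type w} [Preorder A] {E : Type u} [AddCommGroup E]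
    [Lattice E] (N : Set (A → E)) : Prop :=
  ∃ (B : Type u) (_ : Preorder B) (_ : IsDirectedOrder B) (_ : Nonempty B) (g : B → E),
    DecreasesToZero g ∧
      ∀ b : B, ∃ a₀ : A, ∀ a : A, a₀ ≤ a → ∀ x ∈ N, |x a| ≤ g b

/-- A set `S` of linear operators is collectively order continuous if `{(T x_α) : T ∈ S}`
collectively order converges to `0` for every net `x` that order converges to `0`.
Index sets in the universe of `E` suffice: a net in `E` dominated by `g ↓ 0` is handled by the net
of all pairs `(g_β, z)` with `|z| ≤ g_β`, directed by decreasing `g_β`. -/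
def CollectivelyOrderContinuous {E : Type u} {F : Type v}
    [AddCommGroup E] [Lattice E] [Module ℝ E] [AddCommGroup F] [Lattice F] [Module ℝ F]
    (S : Set (E →ₗ[ℝ] F)) : Prop :=
  ∀ (A : Type u) [Preorder A] [IsDirectedOrder A] [Nonempty A] (x : A → E),
    OrderConverges x 0 →
      CollectivelyOrderConvergesToZero {y : A → F | ∃ T ∈ S, y = fun a => T (x a)}

/-- `T` is a positive operator. -/
def IsPositive {E : Type u} {F : Type v}
    [AddCommGroup E] [Lattice E] [Module ℝ E] [AddCommGroup F] [Lattice F] [Module ℝ F]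
    (T : E →ₗ[ℝ] F) : Prop :=
  ∀ x : E, 0 ≤ x → 0 ≤ T x

/-- The Dedekind complete vector lattice `D`, with the embedding `ι`, is a Dedekind completion of
`E`: `ι` is a Riesz isomorphism of `E` onto a majorizing, order dense vector sublattice of `D`. -/
structure IsDedekindCompletion {E : Type u} {D : Type w}
    [AddCommGroup E] [Lattice E] [Module ℝ E]
    [AddCommGroup D] [ConditionallyCompleteLattice D] [Module ℝ D]
    (ι : E →ₗ[ℝ] D) : Prop where
  injective : Function.Injective ι
  map_sup : ∀ x y : E, ι (x ⊔ y) = ι x ⊔ ι y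
  majorizing : ∀ y : D, ∃ x : E, y ≤ ι x
  orderDense : ∀ y : D, 0 < y → ∃ x : E, 0 < x ∧ ι x ≤ y

/-- `R` is the extension `T^δ` of the operator `T`: the linear operator on `D` given on positive
elements by `R y = sup {T x : x ∈ E, x ≤ y}`. There is at most one such `R`, since the positive
elements span `D`. -/
def IsDeltaExtension {E : Type u} {F : Type v} {D : Type w}
    [AddCommGroup E] [Lattice E] [Module ℝ E] [AddCommGroup F] [Lattice F] [Module ℝ F]
    [AddCommGroup D] [Lattice D] [Module ℝ D]
    (ι : E →ₗ[ℝ] D) (T : E →ₗ[ℝ] F) (R : D →ₗ[ℝ] F) : Prop :=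
  ∀ y : D, 0 ≤ y → IsLUB {z : F | ∃ x : E, ι x ≤ y ∧ z = T x} (R y)

/-- The set `S^δ = {T^δ : T ∈ S}`. -/
def deltaExtensions {E : Type u} {F : Type v} {D : Type w}
    [AddCommGroup E] [Lattice E] [Module ℝ E] [AddCommGroup F] [Lattice F] [Module ℝ F]
    [AddCommGroup D] [Lattice D] [Module ℝ D]
    (ι : E →ₗ[ℝ] D) (S : Set (E →ₗ[ℝ] F)) : Set (D →ₗ[ℝ] F) :=
  {R | ∃ T ∈ S, IsDeltaExtension ι T R}

end VL

/-! By positivity, a bound on `T e` controls `T x` whenever `|x| ≤ e`, so both conditions reduce to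
one question: are downward directed sets with infimum `0` sent collectively to `0`
(`exists_dominating`)? Such sets pass from `E` to `D` through `ι` by order density (`isGLB_image`),
and from `D` to `E` by taking majorants (`isGLB_majorants`, which needs `E` Archimedean). As `T^δ`
and `T` agree on positive elements of `E`, the same dominating net in `F` serves both sides.

`T^δ` exists because order continuity of `T` closes the gap between the lower extension, which is
superadditive, and the upper one, which is subadditive. -/

namespace VL

universe u v w

set_option linter.unusedSectionVars false

/-! ### Directed sets and positive operators -/

section Nets

variable {E : Type u} {F : Type v}
  [AddCommGroup E] [Lattice E] [IsOrderedAddMonoid E] [Module ℝ E]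
  [AddCommGroup F] [Lattice F] [IsOrderedAddMonoid F] [Module ℝ F]

/-- A collectively order continuous set of operators maps a downward directed set with infimum `0`
collectively to `0`. -/
theorem CollectivelyOrderContinuous.exists_dominating {S : Set (E →ₗ[ℝ] F)}
    (hS : CollectivelyOrderContinuous S) {G : Set E} (hne : G.Nonempty)
    (hdir : DirectedOn (· ≥ ·) G) (hG : IsGLB G 0) :
    ∃ (B : Type v) (_ : Preorder B) (_ : IsDirectedOrder B) (_ : Nonempty B) (g : B → F),
      DecreasesToZero g ∧ ∀ b : B, ∃ e ∈ G, ∀ T ∈ S, |T e| ≤ g b := by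
  have hdir' : IsDirectedOrder (↥G)ᵒᵈ := by
    refine ⟨fun a b => ?_⟩
    obtain ⟨c, hc, hca, hcb⟩ := hdir _ (OrderDual.ofDual a).2 _ (OrderDual.ofDual b).2
    exact ⟨OrderDual.toDual ⟨c, hc⟩, hca, hcb⟩
  have hne' : Nonempty (↥G)ᵒᵈ := ⟨OrderDual.toDual ⟨_, hne.some_mem⟩⟩
  -- `G` with reversed order is a net indexed by itself; being positive and decreasing, it is its
  -- own dominating net.
  have hconv : OrderConverges (fun a : (↥G)ᵒᵈ => ((OrderDual.ofDual a : G) : E)) 0 := by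
    refine ⟨(↥G)ᵒᵈ, inferInstance, hdir', hne', fun a => ((OrderDual.ofDual a : G) : E),
      ⟨fun a b hab => hab, ?_⟩, fun b => ⟨b, fun a hab => ?_⟩⟩
    · have : Set.range (fun a : (↥G)ᵒᵈ => ((OrderDual.ofDual a : G) : E)) = G :=
        Subtype.range_coe (s := G)
      rwa [this]
    · rw [sub_zero, abs_of_nonneg (hG.1 (OrderDual.ofDual a).2)]
      exact hab
  obtain ⟨B, i₁, i₂, i₃, g, hg, h⟩ := hS (↥G)ᵒᵈ _ hconv
  refine ⟨B, i₁, i₂, i₃, g, hg, fun b => ?_⟩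
  obtain ⟨a, ha⟩ := h b
  exact ⟨_, (OrderDual.ofDual a).2, fun T hT => ha a le_rfl _ ⟨T, hT, rfl⟩⟩

theorem IsPositive.monotone {T : E →ₗ[ℝ] F} (hT : IsPositive T) : Monotone T := by
  intro x y hxy
  simpa using hT (y - x) (sub_nonneg.2 hxy)

theorem IsPositive.abs_le {T : E →ₗ[ℝ] F} (hT : IsPositive T) {x y : E} (h : |x| ≤ y) :
    |T x| ≤ T y := by
  refine sup_le (hT.monotone ((le_abs_self x).trans h)) ?_
  rw [← map_neg]
  exact hT.monotone ((neg_le_abs x).trans h)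

end Nets

/-! ### Order approximation in the Dedekind completion -/

section Completion

variable {E : Type u} {F : Type v} {D : Type w}
  [AddCommGroup E] [Lattice E] [IsOrderedAddMonoid E] [Module ℝ E]
  [AddCommGroup D] [ConditionallyCompleteLattice D] [IsOrderedAddMonoid D] [Module ℝ D]
  {ι : E →ₗ[ℝ] D}

theorem IsDedekindCompletion.le_iff (hι : IsDedekindCompletion ι) {x y : E} :
    ι x ≤ ι y ↔ x ≤ y := by
  rw [← sup_eq_right, ← hι.map_sup, hι.injective.eq_iff, sup_eq_right]

theorem IsDedekindCompletion.map_inf (hι : IsDedekindCompletion ι) (x y : E) :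
    ι (x ⊓ y) = ι x ⊓ ι y := by
  have h := hι.map_sup (-x) (-y)
  rw [← neg_inf, map_neg, map_neg, map_neg, ← neg_inf] at h
  exact neg_injective h

theorem IsDedekindCompletion.exists_le (hι : IsDedekindCompletion ι) (y : D) :
    ∃ x : E, ι x ≤ y := by
  obtain ⟨x, hx⟩ := hι.majorizing (-y)
  exact ⟨-x, by rw [map_neg]; exact neg_le.1 hx⟩

/-- The embedding into a Dedekind completion preserves infima equal to `0`. -/
theorem IsDedekindCompletion.isGLB_image (hι : IsDedekindCompletion ι) {G : Set E}
    (hG : IsGLB G 0) : IsGLB (ι '' G) 0 := by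
  refine ⟨?_, fun l hl => ?_⟩
  · rintro _ ⟨x, hx, rfl⟩
    simpa using hι.le_iff.2 (hG.1 hx)
  · by_contra hl0
    have hpos : 0 < l ⊔ 0 := lt_of_le_of_ne le_sup_right fun h => hl0 (sup_eq_right.1 h.symm)
    obtain ⟨x, hx, hxl⟩ := hι.orderDense _ hpos
    refine hx.not_ge (hG.2 fun y hy => hι.le_iff.1 (hxl.trans (sup_le (hl ⟨y, hy, rfl⟩) ?_)))
    simpa using hι.le_iff.2 (hG.1 hy)

/-- Every element of a Dedekind completion is the supremum of the elements of `E` below it. -/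
theorem IsDedekindCompletion.isLUB (hι : IsDedekindCompletion ι) (hE : IsArchimedean E) (y : D) :
    IsLUB {d | ∃ x : E, ι x ≤ y ∧ d = ι x} y := by
  refine ⟨?_, fun u hu => ?_⟩
  · rintro _ ⟨x, hx, rfl⟩
    exact hx
  by_contra hyu
  have hpos : 0 < y - y ⊓ u :=
    sub_pos.2 (lt_of_le_of_ne inf_le_left fun h => hyu (inf_eq_left.1 h))
  obtain ⟨x₀, hx₀, hx₀y⟩ := hι.orderDense _ hpos
  obtain ⟨x, hx⟩ := hι.exists_le y
  obtain ⟨z, hz⟩ := hι.majorizing y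
  -- If `ι w ≤ y` then also `ι w ≤ u`, so `ι w ≤ y ⊓ u`; since `ι x₀ ≤ y - y ⊓ u`, adding `x₀` to
  -- `w` stays below `y`. Iterating contradicts the Archimedean property.
  have key : ∀ n : ℕ, ι (n • x₀ + x) ≤ y := by
    intro n
    induction n with
    | zero => simpa using hx
    | succ n ih =>
      have h := add_le_add hx₀y (le_inf ih (hu ⟨_, ih, rfl⟩))
      rw [sub_add_cancel, ← map_add] at h
      rwa [succ_nsmul', add_assoc]
  exact hx₀.ne' (hE x₀ (z - x) hx₀.le fun n =>
    le_sub_iff_add_le.2 (hι.le_iff.1 ((key n).trans hz)))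

/-- Every element of a Dedekind completion is the infimum of the elements of `E` above it. -/
theorem IsDedekindCompletion.isGLB (hι : IsDedekindCompletion ι) (hE : IsArchimedean E) (y : D) :
    IsGLB {d | ∃ x : E, y ≤ ι x ∧ d = ι x} y := by
  refine ⟨?_, fun u hu => ?_⟩
  · rintro _ ⟨x, hx, rfl⟩
    exact hx
  refine neg_le_neg_iff.1 ((hι.isLUB hE (-y)).2 ?_)
  rintro _ ⟨x, hx, rfl⟩
  rw [le_neg, ← map_neg]
  exact hu ⟨-x, by rw [map_neg]; exact le_neg.1 hx, rfl⟩

/-- A downward directed subset of the completion with infimum `0` has majorants in `E` with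
infimum `0`. -/
theorem IsDedekindCompletion.isGLB_majorants (hι : IsDedekindCompletion ι)
    (hE : IsArchimedean E) {H : Set D} (hH : IsGLB H 0) :
    IsGLB {e : E | ∃ d ∈ H, d ≤ ι e} 0 := by
  refine ⟨?_, fun l hl => ?_⟩
  · rintro e ⟨d, hd, hde⟩
    exact hι.le_iff.1 (by simpa using (hH.1 hd).trans hde)
  · refine hι.le_iff.1 ?_
    rw [map_zero]
    refine hH.2 fun d hd => (hι.isGLB hE d).2 ?_
    rintro _ ⟨e, hde, rfl⟩
    exact hι.le_iff.2 (hl ⟨d, hd, hde⟩)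

/-- The differences between majorants and minorants in `E` of an element of the completion. -/
def gaps (ι : E →ₗ[ℝ] D) (y : D) : Set E :=
  {e | ∃ x z : E, ι x ≤ y ∧ y ≤ ι z ∧ e = z - x}

theorem IsDedekindCompletion.gaps_nonempty (hι : IsDedekindCompletion ι) (y : D) :
    (gaps ι y).Nonempty := by
  obtain ⟨x, hx⟩ := hι.exists_le y
  obtain ⟨z, hz⟩ := hι.majorizing y
  exact ⟨z - x, x, z, hx, hz, rfl⟩

theorem IsDedekindCompletion.directedOn_gaps (hι : IsDedekindCompletion ι) (y : D) :
    DirectedOn (· ≥ ·) (gaps ι y) := by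
  rintro _ ⟨x₁, z₁, hx₁, hz₁, rfl⟩ _ ⟨x₂, z₂, hx₂, hz₂, rfl⟩
  refine ⟨z₁ ⊓ z₂ - (x₁ ⊔ x₂), ⟨_, _, ?_, ?_, rfl⟩, sub_le_sub inf_le_left le_sup_left,
    sub_le_sub inf_le_right le_sup_right⟩
  · rw [hι.map_sup]
    exact sup_le hx₁ hx₂
  · rw [hι.map_inf]
    exact le_inf hz₁ hz₂

/-- An element of `D` is both the supremum of its minorants and the infimum of its majorants in `E`,
so a lower bound `l` of the gaps satisfies `y ≤ y - ι l`. -/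
theorem IsDedekindCompletion.isGLB_gaps (hι : IsDedekindCompletion ι) (hE : IsArchimedean E)
    (y : D) : IsGLB (gaps ι y) 0 := by
  refine ⟨?_, fun l hl => ?_⟩
  · rintro _ ⟨x, z, hx, hz, rfl⟩
    exact sub_nonneg.2 (hι.le_iff.1 (hx.trans hz))
  have h : y ≤ y - ι l := by
    refine (hι.isLUB hE y).2 ?_
    rintro _ ⟨x, hx, rfl⟩
    rw [le_sub_comm]
    rw [le_sub_iff_add_le, add_comm]
    refine (hι.isGLB hE y).2 ?_
    rintro _ ⟨z, hz, rfl⟩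
    rw [← map_add]
    have := hl ⟨x, z, hx, hz, rfl⟩
    exact hι.le_iff.2 (by rwa [le_sub_iff_add_le, add_comm] at this)
  have h0 : ι l ≤ 0 := by simpa using h
  exact hι.le_iff.1 (by simpa using h0)

end Completion

/-! ### Existence and continuity of the extension -/

section Extension

variable {E : Type u} {F : Type v} {D : Type w}
  [AddCommGroup E] [Lattice E] [IsOrderedAddMonoid E] [Module ℝ E]
  [AddCommGroup D] [ConditionallyCompleteLattice D] [IsOrderedAddMonoid D] [Module ℝ D]
  {ι : E →ₗ[ℝ] D}

theorem IsDeltaExtension.unique [AddCommGroup F] [Lattice F] [Module ℝ F]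
    {T : E →ₗ[ℝ] F} {R R' : D →ₗ[ℝ] F}
    (hR : IsDeltaExtension ι T R) (hR' : IsDeltaExtension ι T R') : R = R' := by
  ext y
  rw [← posPart_sub_negPart y, map_sub, map_sub,
    (hR _ (posPart_nonneg y)).unique (hR' _ (posPart_nonneg y)),
    (hR _ (negPart_nonneg y)).unique (hR' _ (negPart_nonneg y))]

theorem IsDeltaExtension.isPositive [AddCommGroup F] [Lattice F] [Module ℝ F]
    {T : E →ₗ[ℝ] F} {R : D →ₗ[ℝ] F} (hR : IsDeltaExtension ι T R) : IsPositive R :=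
  fun y hy => (hR y hy).1 ⟨0, by simpa using hy, by simp⟩

theorem IsDeltaExtension.apply_eq [AddCommGroup F] [Lattice F] [IsOrderedAddMonoid F] [Module ℝ F]
    (hι : IsDedekindCompletion ι) {T : E →ₗ[ℝ] F} (hT : IsPositive T) {R : D →ₗ[ℝ] F}
    (hR : IsDeltaExtension ι T R) {x : E} (hx : 0 ≤ x) : R (ι x) = T x := by
  refine (hR (ι x) (by simpa using hι.le_iff.2 hx)).unique ⟨?_, fun u hu => hu ⟨x, le_rfl, rfl⟩⟩
  rintro _ ⟨z, hz, rfl⟩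
  exact hT.monotone (hι.le_iff.1 hz)

variable [AddCommGroup F] [ConditionallyCompleteLattice F] [IsOrderedAddMonoid F] [Module ℝ F]

theorem IsDedekindCompletion.isLUB_sSup (hι : IsDedekindCompletion ι) {T : E →ₗ[ℝ] F}
    (hT : IsPositive T) (y : D) :
    IsLUB {f : F | ∃ x : E, ι x ≤ y ∧ f = T x} (sSup {f : F | ∃ x : E, ι x ≤ y ∧ f = T x}) := by
  obtain ⟨x, hx⟩ := hι.exists_le y
  obtain ⟨z, hz⟩ := hι.majorizing y
  refine isLUB_csSup ⟨T x, x, hx, rfl⟩ ⟨T z, ?_⟩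
  rintro _ ⟨x', hx', rfl⟩
  exact hT.monotone (hι.le_iff.1 (hx'.trans hz))

/-- If `T` maps the gaps of each element of the completion to sets with infimum `0`, then the
lower extension of `T` is also its upper extension. -/
theorem IsDedekindCompletion.isGLB_sSup (hι : IsDedekindCompletion ι) {T : E →ₗ[ℝ] F}
    (hT : IsPositive T) {y : D} (hgap : IsGLB (T '' gaps ι y) 0) :
    IsGLB {f : F | ∃ z : E, y ≤ ι z ∧ f = T z} (sSup {f : F | ∃ x : E, ι x ≤ y ∧ f = T x}) := by
  have hlub := hι.isLUB_sSup hT y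
  refine ⟨?_, fun u hu => ?_⟩
  · rintro _ ⟨z, hz, rfl⟩
    refine hlub.2 ?_
    rintro _ ⟨x, hx, rfl⟩
    exact hT.monotone (hι.le_iff.1 (hx.trans hz))
  · refine sub_nonpos.1 (hgap.2 ?_)
    rintro _ ⟨_, ⟨x, z, hx, hz, rfl⟩, rfl⟩
    rw [map_sub]
    exact sub_le_sub (hu ⟨z, hz, rfl⟩) (hlub.1 ⟨x, hx, rfl⟩)

theorem IsDedekindCompletion.exists_isDeltaExtension [IsOrderedModule ℝ F] [IsOrderedModule ℝ D]
    (hι : IsDedekindCompletion ι) {T : E →ₗ[ℝ] F}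
    (hT : IsPositive T) (hgap : ∀ y : D, IsGLB (T '' gaps ι y) 0) :
    ∃ R : D →ₗ[ℝ] F, IsDeltaExtension ι T R := by
  set R : D → F := fun y => sSup {f : F | ∃ x : E, ι x ≤ y ∧ f = T x} with hRdef
  have hlub : ∀ y, IsLUB {f : F | ∃ x : E, ι x ≤ y ∧ f = T x} (R y) := hι.isLUB_sSup hT
  have hglb : ∀ y, IsGLB {f : F | ∃ z : E, y ≤ ι z ∧ f = T z} (R y) :=
    fun y => hι.isGLB_sSup hT (hgap y)
  -- Majorants add up, which gives `≤` through `hglb`; minorants add up, which gives `≥` through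
  -- `hlub`.
  have hadd : ∀ y z, R (y + z) = R y + R z := by
    intro y z
    refine le_antisymm ?_ ?_
    · rw [← sub_le_iff_le_add]
      refine (hglb y).2 ?_
      rintro _ ⟨a, ha, rfl⟩
      rw [sub_le_comm]
      refine (hglb z).2 ?_
      rintro _ ⟨b, hb, rfl⟩
      rw [sub_le_iff_le_add', ← map_add]
      exact (hglb (y + z)).1 ⟨a + b, by rw [map_add]; exact add_le_add ha hb, rfl⟩
    · rw [← le_sub_iff_add_le]
      refine (hlub y).2 ?_
      rintro _ ⟨a, ha, rfl⟩
      rw [le_sub_comm]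
      refine (hlub z).2 ?_
      rintro _ ⟨b, hb, rfl⟩
      rw [le_sub_iff_add_le', ← map_add]
      exact (hlub (y + z)).1 ⟨a + b, by rw [map_add]; exact add_le_add ha hb, rfl⟩
  -- One inequality suffices: applied to `c⁻¹` and `c • y` it yields the reverse one.
  have hle : ∀ (c : ℝ) (y : D), 0 < c → R (c • y) ≤ c • R y := by
    intro c y hc
    refine (hlub _).2 ?_
    rintro _ ⟨x, hx, rfl⟩
    have h1 : T (c⁻¹ • x) ≤ R y := by
      refine (hlub y).1 ⟨c⁻¹ • x, ?_, rfl⟩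
      have := smul_le_smul_of_nonneg_left hx (inv_nonneg.2 hc.le)
      rwa [inv_smul_smul₀ hc.ne', ← map_smul] at this
    have := smul_le_smul_of_nonneg_left h1 hc.le
    rwa [map_smul, smul_inv_smul₀ hc.ne'] at this
  have hpos : ∀ (c : ℝ) (y : D), 0 < c → R (c • y) = c • R y := by
    intro c y hc
    refine le_antisymm (hle c y hc) ?_
    have := smul_le_smul_of_nonneg_left (hle c⁻¹ (c • y) (inv_pos.2 hc)) hc.le
    rwa [inv_smul_smul₀ hc.ne', smul_inv_smul₀ hc.ne'] at this
  have hzero : R 0 = 0 := by simpa using hadd 0 0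
  have hneg : ∀ y, R (-y) = -R y := fun y =>
    eq_neg_of_add_eq_zero_left (by rw [← hadd, neg_add_cancel, hzero])
  have hsmul : ∀ (c : ℝ) (y : D), R (c • y) = c • R y := by
    intro c y
    rcases lt_trichotomy c 0 with hc | rfl | hc
    · have := hpos (-c) y (neg_pos.2 hc)
      rwa [neg_smul, neg_smul, hneg, neg_inj] at this
    · rw [zero_smul, zero_smul, hzero]
    · exact hpos c y hc
  exact ⟨{ toFun := R, map_add' := hadd, map_smul' := hsmul }, fun y _ => hlub y⟩

/-- Order continuity of a single member; applied to `gaps ι y`, it supplies the hypothesis under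
which the extension exists. -/
theorem CollectivelyOrderContinuous.isGLB_image {S : Set (E →ₗ[ℝ] F)}
    (hS : CollectivelyOrderContinuous S) {T : E →ₗ[ℝ] F} (hTS : T ∈ S) (hT : IsPositive T)
    {G : Set E} (hne : G.Nonempty) (hdir : DirectedOn (· ≥ ·) G) (hG : IsGLB G 0) :
    IsGLB (T '' G) 0 := by
  refine ⟨?_, fun l hl => ?_⟩
  · rintro _ ⟨e, he, rfl⟩
    exact hT e (hG.1 he)
  · obtain ⟨B, _, _, _, g, hg, h⟩ := hS.exists_dominating hne hdir hG
    refine hg.2.2 ?_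
    rintro _ ⟨b, rfl⟩
    obtain ⟨e, he, hTe⟩ := h b
    exact (hl ⟨e, he, rfl⟩).trans ((le_abs_self _).trans (hTe T hTS))

theorem CollectivelyOrderContinuous.deltaExtensions (hE : IsArchimedean E)
    (hι : IsDedekindCompletion ι) {S : Set (E →ₗ[ℝ] F)} (hS : ∀ T ∈ S, IsPositive T)
    (h : CollectivelyOrderContinuous S) : CollectivelyOrderContinuous (deltaExtensions ι S) := by
  intro A _ _ _ y ⟨B, _, _, _, g, hg, hyg⟩
  have hne : {e : E | ∃ d ∈ Set.range g, d ≤ ι e}.Nonempty := by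
    obtain ⟨e, he⟩ := hι.majorizing (g (Classical.arbitrary B))
    exact ⟨e, _, ⟨_, rfl⟩, he⟩
  have hdir : DirectedOn (· ≥ ·) {e : E | ∃ d ∈ Set.range g, d ≤ ι e} := by
    rintro e₁ ⟨_, ⟨b₁, rfl⟩, h₁⟩ e₂ ⟨_, ⟨b₂, rfl⟩, h₂⟩
    obtain ⟨b, hb₁, hb₂⟩ := exists_ge_ge b₁ b₂
    refine ⟨e₁ ⊓ e₂, ⟨_, ⟨b, rfl⟩, ?_⟩, inf_le_left, inf_le_right⟩
    rw [hι.map_inf]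
    exact le_inf ((hg.1 hb₁).trans h₁) ((hg.1 hb₂).trans h₂)
  -- The dominating net lives in `D`, where `T` is not defined, so it is traded for its majorants in
  -- `E`.
  have hglb := hι.isGLB_majorants hE hg.2
  obtain ⟨C, i₁, i₂, i₃, k, hk, hkS⟩ := h.exists_dominating hne hdir hglb
  refine ⟨C, i₁, i₂, i₃, k, hk, fun c => ?_⟩
  obtain ⟨e, he, hTe⟩ := hkS c
  have he0 : 0 ≤ e := hglb.1 he
  obtain ⟨_, ⟨b, rfl⟩, hbe⟩ := he
  obtain ⟨a₀, ha₀⟩ := hyg b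
  refine ⟨a₀, fun a ha => ?_⟩
  rintro _ ⟨R, ⟨T, hTS, hR⟩, rfl⟩
  have hya : |y a| ≤ ι e := by simpa using (ha₀ a ha).trans hbe
  refine (hR.isPositive.abs_le hya).trans ?_
  rw [hR.apply_eq hι (hS T hTS) he0]
  exact (le_abs_self _).trans (hTe T hTS)

theorem CollectivelyOrderContinuous.of_deltaExtensions
    (hι : IsDedekindCompletion ι) {S : Set (E →ₗ[ℝ] F)} (hS : ∀ T ∈ S, IsPositive T)
    (hex : ∀ T ∈ S, ∃ R : D →ₗ[ℝ] F, IsDeltaExtension ι T R)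
    (h : CollectivelyOrderContinuous (VL.deltaExtensions ι S)) :
    CollectivelyOrderContinuous S := by
  intro A _ _ _ x ⟨B, _, _, _, g, hg, hxg⟩
  have hdir : DirectedOn (· ≥ ·) (ι '' Set.range g) := by
    rintro _ ⟨_, ⟨b₁, rfl⟩, rfl⟩ _ ⟨_, ⟨b₂, rfl⟩, rfl⟩
    obtain ⟨b, hb₁, hb₂⟩ := exists_ge_ge b₁ b₂
    exact ⟨_, ⟨_, ⟨b, rfl⟩, rfl⟩, hι.le_iff.2 (hg.1 hb₁), hι.le_iff.2 (hg.1 hb₂)⟩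
  obtain ⟨C, i₁, i₂, i₃, k, hk, hkS⟩ := h.exists_dominating
    ((Set.range_nonempty g).image ι) hdir (hι.isGLB_image hg.2)
  refine ⟨C, i₁, i₂, i₃, k, hk, fun c => ?_⟩
  obtain ⟨_, ⟨_, ⟨b, rfl⟩, rfl⟩, hRe⟩ := hkS c
  obtain ⟨a₀, ha₀⟩ := hxg b
  refine ⟨a₀, fun a ha => ?_⟩
  rintro _ ⟨T, hTS, rfl⟩
  obtain ⟨R, hR⟩ := hex T hTS
  have hxa : |x a| ≤ g b := by simpa using ha₀ a ha
  refine ((hS T hTS).abs_le hxa).trans ?_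
  rw [← hR.apply_eq hι (hS T hTS) (hg.2.1 ⟨b, rfl⟩)]
  exact (le_abs_self _).trans (hRe R ⟨T, hTS, hR⟩)

end Extension

end VL

theorem proposition2p7 {E : Type*} {F : Type*} {D : Type*}
    [AddCommGroup E] [Lattice E] [IsOrderedAddMonoid E] [Module ℝ E] [IsOrderedModule ℝ E]
    [AddCommGroup F] [ConditionallyCompleteLattice F] [IsOrderedAddMonoid F] [Module ℝ F]
    [IsOrderedModule ℝ F]
    [AddCommGroup D] [ConditionallyCompleteLattice D] [IsOrderedAddMonoid D] [Module ℝ D]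
    [IsOrderedModule ℝ D]
    (hE : VL.IsArchimedean E)
    (ι : E →ₗ[ℝ] D) (hι : VL.IsDedekindCompletion ι)
    (S : Set (E →ₗ[ℝ] F)) (hS : ∀ T ∈ S, VL.IsPositive T) :
    ((∀ T ∈ S, ∃! R : D →ₗ[ℝ] F, VL.IsDeltaExtension ι T R) ∧
        VL.CollectivelyOrderContinuous (VL.deltaExtensions ι S)) ↔
      VL.CollectivelyOrderContinuous S := by
  constructor
  · rintro ⟨hex, h⟩
    exact h.of_deltaExtensions hι hS fun T hT => (hex T hT).exists
  · intro h
    refine ⟨fun T hT => ?_, h.deltaExtensions hE hι hS⟩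
    obtain ⟨R, hR⟩ := hι.exists_isDeltaExtension (hS T hT) fun y =>
      h.isGLB_image hT (hS T hT) (hι.gaps_nonempty y) (hι.directedOn_gaps y) (hι.isGLB_gaps hE y)
    exact ⟨R, hR, fun R' hR' => hR'.unique hR⟩
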